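/- Let $P$ and $Q$ be probability distributions with $Q \ll P$ and $dQ/dP \le C$ $P$-a.e. for a constant $C>0$. Let $r(x;\beta)$, $\beta\in\mathbb{R}^d$, be a (jointly measurable) real-valued parametric family with $r(x;\beta_0) = \frac{dQ}{dP}(x)$ for $P$-almost every $x$, such that $r(x;\cdot)$ is differentiable at $\beta_0$ for $P$-almost every $x$, and $$\int |r(x;\beta)-r(x;\beta_0)|^2\,dP(x) \to 0 \quad\text{as } \|\beta-\beta_0\|\to 0 .$$ Let $f$ be a measurable real-valued function with $\mathbb{E}_P f^4(X)<\infty$, such that $\beta\mapsto \mathbb{E}_P[f(X)\,r(X;\beta)]$ is differentiable at $\beta_0$, with gradient $v := \nabla_\beta\, \mathbb{E}_P[f(X)\,r(X;\beta)]\big|_{\beta=\beta_0}$. For each $n$, let $X_1,\dots,X_n\sim P$, $U_1,\dots,U_n\sim\mathrm{unif}(0,1)$ and $Z_1,\dots,Z_n\sim P$ all be independent. Let $\hat\beta_n=\hat\beta_n(Z_1,\dots,Z_n)$ be an estimator of $\beta_0$ fitted on the separate sample $Z_1,\dots,Z_n$ such that $\sqrt n(\hat\beta_n-\beta_0)\to_d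 \mathcal{N}(0,\Sigma)$ for some positive semidefinite matrix $\Sigma$ (in particular $\hat\beta_n$ is consistent). Put $\hat r_n(x):=r(x;\hat\beta_n)$, and suppose that, almost surely, $\int \hat r_n\,dP=1$ and $0\le\hat r_n(x)\le C$ for $P$-almost every $x$. Accept the $i$-th observation $X_i$ if $U_i<\hat r_n(X_i)/C$, and denote the accepted observations by $\tilde X^n_1,\dots,\tilde X^n_{\Gamma_n}$, where $0\le\Gamma_n\le n$ is the number of acceptances. Let $T_m(x_1,\dots,x_m) := m^{-1/2}\sum_{i=1}^m\{f(x_i)-\mathbb{E}_Q f(X)\}$ for $m\ge 1$, and $T_0:=0$. Then, as $n\to\infty$, $$T_{\Gamma_n}(\tilde X^n_1,\dots,\tilde X^n_{\Gamma_n}) \to_d \mathcal{N}\!\left(0,\ \mathrm{Var}_Q f(X) + v^\top\Sigma v/C\right).$$ -/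

import Mathlib

open MeasureTheory ProbabilityTheory Filter Topology

noncomputable section

namespace RejectionSampling

/-- The uniform distribution on the interval `(0, 1)`. -/
def unif01 : Measure ℝ := volume.restrict (Set.Ioo 0 1)

instance : IsProbabilityMeasure unif01 := ⟨by simp [unif01]⟩

/-- The indices `i` accepted by rejection sampling from proposals `x` with auxiliary uniforms `u`,
density ratio `r` and bound `C`: those with `u i < r (x i) / C`. -/
def accepted {𝓧 : Type*} {n : ℕ} (r : 𝓧 → ℝ) (C : ℝ) (x : Fin n → 𝓧) (u : Fin n → ℝ) :
    Finset (Fin n) :=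
  Finset.univ.filter fun i => u i < r (x i) / C

/-- The number of accepted points. -/
def numAccepted {𝓧 : Type*} {n : ℕ} (r : 𝓧 → ℝ) (C : ℝ) (x : Fin n → 𝓧) (u : Fin n → ℝ) : ℕ :=
  (accepted r C x u).card

/-- The accepted points, listed in their original order. -/
def acceptedSample {𝓧 : Type*} {n : ℕ} (r : 𝓧 → ℝ) (C : ℝ) (x : Fin n → 𝓧) (u : Fin n → ℝ) :
    Fin (numAccepted r C x u) → 𝓧 :=
  fun k => x ((accepted r C x u).orderEmbOfFin rfl k)

/-- The statistic `m ^ (-1/2) * ∑ i, (f (x i) - E_Q f)` of a sample of size `m`.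
It is `0` for the empty sample. -/
def centredMeanStat {𝓧 : Type*} [MeasurableSpace 𝓧] (f : 𝓧 → ℝ) (Q : Measure 𝓧) {m : ℕ}
    (x : Fin m → 𝓧) : ℝ :=
  (Real.sqrt m)⁻¹ * ∑ i, (f (x i) - ∫ y, f y ∂Q)

end RejectionSampling

end

/-! Condition on the separate sample, which fixes the ratio `ρ = r(·; β̂)`. The proposals are then
i.i.d. pairs, so the sum of `g = f - E_Q f` over the accepted points has characteristic function
`stepCharFun ^ n` (`integral_exp_sum_accepted_eq`). The random sample size does not matter: a
rejected proposal contributes the factor 1.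

At frequency `s = t √(C/n)`, a second-order Taylor expansion turns this power into approximately
`exp (i (t/√C) √n ∫ ρ g dP - (t²/2) ∫ ρ g² dP)`. Since `ρ` integrates to 1, differentiability gives
`√n ∫ ρ g dP ≈ ⟨v, √n (β̂ - β₀)⟩`; L² continuity gives `∫ ρ g² dP ≈ Var_Q f`. Both hold uniformly
over `‖√n (β - β₀)‖ ≤ K` (`eventually_norm_stepCharFun_pow_sub_exp_le`), and tightness makes this
enough.

Averaging over the separate sample leaves `exp (-t² Var_Q f / 2)` times the limiting characteristic
function of `√n (β̂ - β₀)` at `(t/√C) v`: sampling noise and estimation noise add as if independent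
(`tendstoInDistribution_sum_accepted`).

The acceptance probability is `1/C` for every valid ratio, so `Γ_n / n → 1/C`, and Slutsky's theorem
replaces the factor `√(C/n)` by `Γ_n^(-1/2)`. -/

namespace RejectionSampling

/-! ### Exact characteristic function of a sum over the accepted points -/

section Acceptance

variable {𝓧 𝓩 : Type*}

lemma sum_accepted_eq_sum_ite {n : ℕ} (ρ g : 𝓧 → ℝ) (C : ℝ) (x : Fin n → 𝓧) (u : Fin n → ℝ) :
    ∑ i ∈ accepted ρ C x u, g (x i) = ∑ i, if u i < ρ (x i) / C then g (x i) else 0 := by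
  rw [accepted, Finset.sum_filter]

lemma exp_sum_accepted {n : ℕ} (ρ g : 𝓧 → ℝ) (C : ℝ) (x : Fin n → 𝓧) (u : Fin n → ℝ) :
    Complex.exp ((∑ i ∈ accepted ρ C x u, g (x i) : ℝ) * Complex.I) =
      ∏ i, if u i < ρ (x i) / C then Complex.exp (g (x i) * Complex.I) else 1 := by
  rw [accepted, ← Finset.prod_filter, ← Complex.exp_sum]
  push_cast
  rw [Finset.sum_mul]

variable [MeasurableSpace 𝓧] [MeasurableSpace 𝓩]

lemma aestronglyMeasurable_exp_mul_I {Y : 𝓧 → ℝ} (hY : Measurable Y) (μ : Measure 𝓧) :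
    AEStronglyMeasurable (fun w => Complex.exp (Y w * Complex.I)) μ := by
  fun_prop

lemma integrable_exp_mul_I {Y : 𝓧 → ℝ} (hY : Measurable Y) (μ : Measure 𝓧) [IsFiniteMeasure μ] :
    Integrable (fun w => Complex.exp (Y w * Complex.I)) μ :=
  Integrable.of_bound (aestronglyMeasurable_exp_mul_I hY μ) 1
    (ae_of_all _ fun x => by rw [Complex.norm_exp_ofReal_mul_I])

lemma measurable_sum_accepted {n : ℕ} {ρ : 𝓧 → 𝓩 → ℝ} (hρ : Measurable (Function.uncurry ρ))
    {g : 𝓧 → ℝ} (hg : Measurable g) (C : ℝ) :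
    Measurable fun w : ((Fin n → 𝓧) × (Fin n → ℝ)) × 𝓩 =>
      ∑ i ∈ accepted (fun x => ρ x w.2) C w.1.1 w.1.2, g (w.1.1 i) := by
  simp_rw [sum_accepted_eq_sum_ite]
  refine Finset.measurable_sum _ fun i _ => Measurable.ite ?_ (by fun_prop) measurable_const
  have h : Measurable fun w : ((Fin n → 𝓧) × (Fin n → ℝ)) × 𝓩 => ρ (w.1.1 i) w.2 :=
    hρ.comp (f := fun w : ((Fin n → 𝓧) × (Fin n → ℝ)) × 𝓩 => (w.1.1 i, w.2)) (by fun_prop)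
  exact measurableSet_lt (by fun_prop) (h.div_const C)

lemma integral_unif01_ite {p : ℝ} (hp0 : 0 ≤ p) (hp1 : p ≤ 1) (a : ℂ) :
    ∫ u, (if u < p then a else 1) ∂unif01 = 1 + p * (a - 1) := by
  have h : ∀ u : ℝ, (if u < p then a else 1) = 1 + (Set.Iio p).indicator (fun _ => a - 1) u := by
    intro u
    by_cases hu : u < p <;> simp [hu]
  have hr : unif01.real (Set.Iio p) = p := by
    have : Set.Iio p ∩ Set.Ioo 0 1 = Set.Ioo 0 p := by
      ext u
      simp only [Set.mem_inter_iff, Set.mem_Iio, Set.mem_Ioo]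
      constructor
      · rintro ⟨h1, h2, -⟩; exact ⟨h2, h1⟩
      · rintro ⟨h1, h2⟩; exact ⟨h2, h1, h2.trans_le hp1⟩
    rw [unif01, measureReal_restrict_apply measurableSet_Iio, this]
    simp [hp0]
  simp_rw [h]
  rw [integral_add (integrable_const _) ((integrable_const _).indicator measurableSet_Iio),
    integral_indicator measurableSet_Iio]
  simp [hr]

/-- The density ratios `ρ` for which rejection sampling with bound `C` is exact. -/
structure IsValidRatio (P : Measure 𝓧) (C : ℝ) (ρ : 𝓧 → ℝ) : Prop where
  measurable : Measurable ρ
  integral_eq_one : ∫ x, ρ x ∂P = 1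
  bounds : ∀ᵐ x ∂P, 0 ≤ ρ x ∧ ρ x ≤ C

variable {P : Measure 𝓧} {C : ℝ} {ρ : 𝓧 → ℝ}

lemma IsValidRatio.integrable_mul (h : IsValidRatio P C ρ) {k : 𝓧 → ℝ} (hk : Integrable k P) :
    Integrable (fun x => ρ x * k x) P := by
  refine hk.bdd_mul (c := C) h.measurable.aestronglyMeasurable ?_
  filter_upwards [h.bounds] with x hx
  rw [Real.norm_eq_abs, abs_of_nonneg hx.1]
  exact hx.2

lemma IsValidRatio.integrable_ofReal_mul (h : IsValidRatio P C ρ) {k : 𝓧 → ℂ}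
    (hk : Integrable k P) : Integrable (fun x => (ρ x : ℂ) * k x) P := by
  have hm := h.measurable
  refine hk.bdd_mul (c := C) (by fun_prop) ?_
  filter_upwards [h.bounds] with x hx
  rw [Complex.norm_real, Real.norm_eq_abs, abs_of_nonneg hx.1]
  exact hx.2

variable [IsProbabilityMeasure P]

lemma IsValidRatio.integrable (h : IsValidRatio P C ρ) : Integrable ρ P := by
  simpa using h.integrable_mul (integrable_const 1)

lemma IsValidRatio.one_le (h : IsValidRatio P C ρ) : 1 ≤ C := by
  have := integral_mono_ae h.integrable (integrable_const C) (h.bounds.mono fun x hx => hx.2)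
  simpa [h.integral_eq_one] using this

/-- The characteristic function of `g X` for one proposal `X`, counted as `0` if rejected. -/
noncomputable def stepCharFun (P : Measure 𝓧) (C : ℝ) (ρ g : 𝓧 → ℝ) : ℂ :=
  1 + (C : ℂ)⁻¹ * ∫ x, (ρ x : ℂ) * (Complex.exp (g x * Complex.I) - 1) ∂P

lemma integrable_exp_sub_one {g : 𝓧 → ℝ} (hg : Measurable g) :
    Integrable (fun x => Complex.exp (g x * Complex.I) - 1) P :=
  (integrable_exp_mul_I hg P).sub (integrable_const _)

/-- A convex combination, with weights `1 - 1/C` and `1/C`, of 1 and the characteristic function of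
`g` under the density `ρ`. The weights are nonnegative because `∫ ρ dP = 1` forces `C ≥ 1`. -/
lemma norm_stepCharFun_le_one (hρ : IsValidRatio P C ρ) {g : 𝓧 → ℝ} (hg : Measurable g) :
    ‖stepCharFun P C ρ g‖ ≤ 1 := by
  have hC := hρ.one_le
  have hC0 : 0 < C := by linarith
  have hI := integrable_exp_mul_I hg P
  have h1 : stepCharFun P C ρ g =
      ((1 - C⁻¹ : ℝ) : ℂ) + (C : ℂ)⁻¹ * ∫ x, (ρ x : ℂ) * Complex.exp (g x * Complex.I) ∂P := by
    have h2 : ∫ x, (ρ x : ℂ) * (Complex.exp (g x * Complex.I) - 1) ∂P =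
        ∫ x, (ρ x : ℂ) * Complex.exp (g x * Complex.I) ∂P - 1 := by
      simp_rw [mul_sub, mul_one]
      have hρ' : Integrable (fun x => (ρ x : ℂ)) P := hρ.integrable.ofReal
      rw [integral_sub (hρ.integrable_ofReal_mul hI) hρ', integral_complex_ofReal,
        hρ.integral_eq_one, Complex.ofReal_one]
    rw [stepCharFun, h2]
    push_cast
    ring
  have h3 : ‖∫ x, (ρ x : ℂ) * Complex.exp (g x * Complex.I) ∂P‖ ≤ 1 := by
    rw [← hρ.integral_eq_one]
    refine norm_integral_le_of_norm_le hρ.integrable ?_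
    filter_upwards [hρ.bounds] with x hx
    rw [norm_mul, Complex.norm_exp_ofReal_mul_I, mul_one, Complex.norm_real, Real.norm_eq_abs,
      abs_of_nonneg hx.1]
  have hC1 : C⁻¹ ≤ 1 := inv_le_one_of_one_le₀ hC
  rw [h1]
  calc _ ≤ ‖((1 - C⁻¹ : ℝ) : ℂ)‖ +
        ‖(C : ℂ)⁻¹ * ∫ x, (ρ x : ℂ) * Complex.exp (g x * Complex.I) ∂P‖ := norm_add_le _ _
    _ ≤ (1 - C⁻¹) + C⁻¹ * 1 := by
        rw [norm_mul, norm_inv, Complex.norm_real, Complex.norm_real, Real.norm_eq_abs,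
          Real.norm_eq_abs, abs_of_pos hC0, abs_of_nonneg (by linarith)]
        gcongr
    _ = 1 := by ring

/-- The exponential is a product over proposals; integrating out the uniforms and then the proposals
preserves the product structure, leaving `n` equal factors. -/
lemma integral_exp_sum_accepted (hρ : IsValidRatio P C ρ) {g : 𝓧 → ℝ} (hg : Measurable g) (n : ℕ) :
    ∫ w : (Fin n → 𝓧) × (Fin n → ℝ),
      Complex.exp ((∑ i ∈ accepted ρ C w.1 w.2, g (w.1 i) : ℝ) * Complex.I)
        ∂((Measure.pi fun _ => P).prod (Measure.pi fun _ => unif01)) =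
      stepCharFun P C ρ g ^ n := by
  have hC0 : 0 < C := by linarith [hρ.one_le]
  have hm : Measurable fun w : (Fin n → 𝓧) × (Fin n → ℝ) =>
      ∑ i ∈ accepted ρ C w.1 w.2, g (w.1 i) :=
    (measurable_sum_accepted (𝓩 := Unit) (ρ := fun x _ => ρ x)
      (hρ.measurable.comp measurable_fst) hg C).comp (measurable_prodMk_right (y := ()))
  rw [integral_prod _ (integrable_exp_mul_I hm _)]
  simp_rw [exp_sum_accepted]
  have h1 : ∀ x : Fin n → 𝓧, ∫ u : Fin n → ℝ,
      ∏ i, (if u i < ρ (x i) / C then Complex.exp (g (x i) * Complex.I) else 1)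
        ∂(Measure.pi fun _ => unif01) =
      ∏ i, ∫ u, (if u < ρ (x i) / C then Complex.exp (g (x i) * Complex.I) else 1) ∂unif01 :=
    fun x => integral_fintype_prod_eq_prod (𝕜 := ℂ)
      fun i u => if u < ρ (x i) / C then Complex.exp (g (x i) * Complex.I) else 1
  simp_rw [h1]
  rw [integral_fintype_prod_eq_pow
    (fun y => ∫ u, (if u < ρ y / C then Complex.exp (g y * Complex.I) else 1) ∂unif01),
    Fintype.card_fin]
  congr 1
  have h2 : ∀ᵐ y ∂P, ∫ u, (if u < ρ y / C then Complex.exp (g y * Complex.I) else 1) ∂unif01 =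
      1 + (C : ℂ)⁻¹ * ((ρ y : ℂ) * (Complex.exp (g y * Complex.I) - 1)) := by
    filter_upwards [hρ.bounds] with y hy
    rw [integral_unif01_ite (div_nonneg hy.1 hC0.le) ((div_le_one hC0).2 hy.2)]
    push_cast
    ring
  rw [integral_congr_ae h2, integral_add (integrable_const _)
    ((hρ.integrable_ofReal_mul (integrable_exp_sub_one hg)).const_mul _), integral_const_mul,
    stepCharFun]
  simp

/-- Allows almost sure validity to be transferred from the underlying space to the law of the
separate sample. -/
lemma measurableSet_isValidRatio {ρ : 𝓧 → 𝓩 → ℝ} (hρ : Measurable (Function.uncurry ρ)) (C : ℝ) :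
    MeasurableSet {z | IsValidRatio P C fun x => ρ x z} := by
  have hρ' : Measurable fun p : 𝓩 × 𝓧 => ρ p.2 p.1 := hρ.comp measurable_swap
  have h1 : MeasurableSet {z | ∫ x, ρ x z ∂P = 1} :=
    measurableSet_eq_fun
      (hρ'.stronglyMeasurable.integral_prod_right (ν := P)).measurable measurable_const
  have h2 : MeasurableSet {z | ∀ᵐ x ∂P, 0 ≤ ρ x z ∧ ρ x z ≤ C} := by
    have hs : MeasurableSet {p : 𝓩 × 𝓧 | 0 ≤ ρ p.2 p.1 ∧ ρ p.2 p.1 ≤ C} :=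
      (measurableSet_le measurable_const hρ').inter (measurableSet_le hρ' measurable_const)
    exact (measurable_measure_prodMk_left (ν := P) hs.compl) (measurableSet_singleton 0)
  convert h1.inter h2 using 1
  ext z
  exact ⟨fun h => ⟨h.2, h.3⟩, fun h =>
    ⟨hρ.comp (f := fun x => (x, z)) (by fun_prop), h.1, h.2⟩⟩

lemma measurable_stepCharFun {ρ : 𝓧 → 𝓩 → ℝ} (hρ : Measurable (Function.uncurry ρ)) {g : 𝓧 → ℝ}
    (hg : Measurable g) (C : ℝ) : Measurable fun z => stepCharFun P C (fun x => ρ x z) g := by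
  have hρ' : Measurable fun p : 𝓩 × 𝓧 => ρ p.2 p.1 := hρ.comp measurable_swap
  have h : Measurable fun p : 𝓩 × 𝓧 =>
      (ρ p.2 p.1 : ℂ) * (Complex.exp (g p.2 * Complex.I) - 1) := by fun_prop
  exact ((h.stronglyMeasurable.integral_prod_right (ν := P)).measurable.const_mul _).const_add _

/-- The characteristic function of a sum over the accepted points, when the density ratio is
computed from an independent sample. -/
lemma integral_exp_sum_accepted_eq {Ω : Type*} [MeasurableSpace Ω] {μ : Measure Ω} {n : ℕ}
    {ν : Measure 𝓩} [IsProbabilityMeasure ν]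
    {X : Ω → Fin n → 𝓧} {U : Ω → Fin n → ℝ} {Z : Ω → 𝓩}
    (hlaw : HasLaw (fun ω => ((X ω, U ω), Z ω))
      (((Measure.pi fun _ : Fin n => P).prod (Measure.pi fun _ : Fin n => unif01)).prod ν) μ)
    {ρ : 𝓧 → 𝓩 → ℝ} (hρ : Measurable (Function.uncurry ρ))
    (hvalid : ∀ᵐ ω ∂μ, IsValidRatio P C fun x => ρ x (Z ω)) {g : 𝓧 → ℝ} (hg : Measurable g) :
    ∫ ω, Complex.exp
        ((∑ i ∈ accepted (fun x => ρ x (Z ω)) C (X ω) (U ω), g (X ω i) : ℝ) * Complex.I) ∂μ =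
      ∫ ω, stepCharFun P C (fun x => ρ x (Z ω)) g ^ n ∂μ := by
  have hZ : HasLaw Z ν μ :=
    (measurePreserving_snd (μ := (Measure.pi fun _ : Fin n => P).prod
      (Measure.pi fun _ : Fin n => unif01)) (ν := ν)).comp_hasLaw hlaw
  have hv : ∀ᵐ z ∂ν, IsValidRatio P C fun x => ρ x z := by
    rw [← hZ.map_eq]
    exact (ae_map_iff hZ.aemeasurable (measurableSet_isValidRatio hρ C)).2 hvalid
  have hS := measurable_sum_accepted (n := n) hρ hg C
  have e1 := hlaw.integral_comp (f := fun w : ((Fin n → 𝓧) × (Fin n → ℝ)) × 𝓩 =>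
    Complex.exp ((∑ i ∈ accepted (fun x => ρ x w.2) C w.1.1 w.1.2, g (w.1.1 i) : ℝ) * Complex.I))
    (aestronglyMeasurable_exp_mul_I hS _)
  have e2 := hZ.integral_comp (f := fun z => stepCharFun P C (fun x => ρ x z) g ^ n)
    ((measurable_stepCharFun hρ hg C).pow_const n).aestronglyMeasurable
  simp only [Function.comp_def] at e1 e2
  rw [e1, e2, integral_prod_symm _ (integrable_exp_mul_I hS _)]
  refine integral_congr_ae ?_
  filter_upwards [hv] with z hz using integral_exp_sum_accepted hz hg n

end Acceptance

/-! ### Estimates for the complex exponential -/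

section Exponential

/-- For `|y| ≤ 1` this is the usual Taylor remainder; for `|y| > 1` each of the four terms is at
most a multiple of `|y|³`, with multiples adding up to 7/2. -/
lemma norm_exp_mul_I_taylor_two_le (y : ℝ) :
    ‖Complex.exp (y * Complex.I) - 1 - y * Complex.I + y ^ 2 / 2‖ ≤ 4 * |y| ^ 3 := by
  rcases le_or_gt |y| 1 with hy | hy
  · have h := Complex.exp_bound (x := y * Complex.I) (by simpa using hy) (n := 3) (by norm_num)
    have e : Complex.exp (y * Complex.I) - 1 - y * Complex.I + y ^ 2 / 2 =
        Complex.exp (y * Complex.I) -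
          ∑ m ∈ Finset.range 3, (y * Complex.I) ^ m / (m.factorial : ℂ) := by
      simp [Finset.sum_range_succ, mul_pow]
      ring
    rw [e]
    refine h.trans ?_
    have : 0 ≤ |y| ^ 3 := by positivity
    norm_num [Nat.factorial]
    linarith
  · have h1 : (1 : ℝ) ≤ |y| ^ 3 := one_le_pow₀ hy.le
    have h2 : |y| ≤ |y| ^ 3 := le_self_pow₀ hy.le (by norm_num)
    have h3 : |y| ^ 2 ≤ |y| ^ 3 := pow_le_pow_right₀ hy.le (by norm_num)
    calc _ ≤ ‖Complex.exp (y * Complex.I)‖ + ‖(1 : ℂ)‖ + ‖(y * Complex.I : ℂ)‖ +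
          ‖((y : ℂ) ^ 2 / 2)‖ :=
          (norm_add_le _ _).trans (add_le_add_left ((norm_sub_le _ _).trans
            (add_le_add_left (norm_sub_le _ _) _)) _)
      _ = 1 + 1 + |y| + |y| ^ 2 / 2 := by
          rw [Complex.norm_exp_ofReal_mul_I]; simp
      _ ≤ _ := by linarith

lemma norm_pow_sub_pow_le_of_norm_le_one {z w : ℂ} (hz : ‖z‖ ≤ 1) (hw : ‖w‖ ≤ 1) (n : ℕ) :
    ‖z ^ n - w ^ n‖ ≤ n * ‖z - w‖ := by
  induction n with
  | zero => simp
  | succ n ih =>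
    have e : z ^ (n + 1) - w ^ (n + 1) = z ^ n * (z - w) + (z ^ n - w ^ n) * w := by ring
    have hzn : ‖z ^ n‖ ≤ 1 := by rw [norm_pow]; exact pow_le_one₀ (norm_nonneg _) hz
    calc _ ≤ ‖z ^ n‖ * ‖z - w‖ + ‖z ^ n - w ^ n‖ * ‖w‖ := by
          rw [e, ← norm_mul, ← norm_mul]; exact norm_add_le _ _
      _ ≤ 1 * ‖z - w‖ + n * ‖z - w‖ * 1 := by gcongr
      _ = _ := by push_cast; ring

/-- Quantitative form of `(1 + a / n) ^ n → exp b` as `a → b`. -/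
lemma norm_pow_sub_exp_le {a b z : ℂ} {n : ℕ} (hn : 0 < n) (hz : z = 1 + a / n) (hz1 : ‖z‖ ≤ 1)
    (hb : b.re ≤ 0) (hbn : ‖b‖ ≤ n) :
    ‖z ^ n - Complex.exp b‖ ≤ ‖a - b‖ + ‖b‖ ^ 2 / n := by
  have hn0 : (n : ℂ) ≠ 0 := by exact_mod_cast hn.ne'
  -- Writing `exp b` as an `n`-th power reduces the claim to comparing bases in the unit disc, at
  -- the cost of a factor `n`.
  have hn0' : (0 : ℝ) < n := by exact_mod_cast hn
  have e : Complex.exp b = Complex.exp (b / n) ^ n := by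
    rw [← Complex.exp_nat_mul, mul_div_cancel₀ _ hn0]
  have hw : ‖Complex.exp (b / n)‖ ≤ 1 := by
    rw [Complex.norm_exp, Complex.div_natCast_re]
    exact Real.exp_le_one_iff.2 (div_nonpos_of_nonpos_of_nonneg hb hn0'.le)
  have hbn' : ‖b / n‖ ≤ 1 := by
    rw [norm_div, Complex.norm_natCast]
    exact (div_le_one hn0').2 hbn
  have h1 := Complex.norm_exp_sub_one_sub_id_le hbn'
  rw [e]
  calc _ ≤ n * ‖z - Complex.exp (b / n)‖ := norm_pow_sub_pow_le_of_norm_le_one hz1 hw n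
    _ = n * ‖(a - b) / n - (Complex.exp (b / n) - 1 - b / n)‖ := by
        congr 2; rw [hz]; ring
    _ ≤ n * (‖a - b‖ / n + ‖b / n‖ ^ 2) := by
        gcongr
        refine (norm_sub_le _ _).trans ?_
        gcongr
        rw [norm_div, Complex.norm_natCast]
    _ = _ := by
        rw [norm_div, Complex.norm_natCast]; field_simp

end Exponential

/-! ### Convergence in distribution: portmanteau, tightness, Lévy continuity -/

section Distribution

variable {E Ω' : Type*} {Ω : ℕ → Type*} [∀ n, MeasurableSpace (Ω n)] {μ : ∀ n, Measure (Ω n)}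
  [∀ n, IsProbabilityMeasure (μ n)] [MeasurableSpace Ω'] {μ' : Measure Ω'} [IsProbabilityMeasure μ']
  [MeasurableSpace E]

lemma _root_.MeasureTheory.TendstoInDistribution.eventually_measureReal_lt [TopologicalSpace E]
    [OpensMeasurableSpace E] [HasOuterApproxClosed E]
    {H : ∀ n, Ω n → E} {H' : Ω' → E}
    (h : TendstoInDistribution H atTop H' μ μ') {F : Set E} (hF : IsClosed F) {ε : ℝ}
    (hε : μ'.real (H' ⁻¹' F) < ε) : ∀ᶠ n in atTop, (μ n).real (H n ⁻¹' F) < ε := by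
  have h1 := ProbabilityMeasure.limsup_measure_closed_le_of_tendsto h.tendsto hF
  have hε0 : 0 < ε := measureReal_nonneg.trans_lt hε
  have h2 : μ' (H' ⁻¹' F) < ENNReal.ofReal ε := by
    rw [← ofReal_measureReal]
    exact (ENNReal.ofReal_lt_ofReal_iff hε0).2 hε
  simp only [ProbabilityMeasure.coe_mk] at h1
  rw [Measure.map_apply_of_aemeasurable h.aemeasurable_limit hF.measurableSet] at h1
  filter_upwards [eventually_lt_of_limsup_lt (h1.trans_lt h2)] with n hn
  rw [Measure.map_apply_of_aemeasurable (h.forall_aemeasurable n) hF.measurableSet,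
    ← ofReal_measureReal] at hn
  exact (ENNReal.ofReal_lt_ofReal_iff hε0).1 hn

/-- Tightness: the closed sets `{k ≤ ‖x‖}` decrease to the empty set, so one of them has small limit
mass, and the portmanteau bound carries this to large `n`. -/
lemma _root_.MeasureTheory.TendstoInDistribution.exists_eventually_measureReal_norm_lt
    [NormedAddCommGroup E] [BorelSpace E] {H : ∀ n, Ω n → E} {H' : Ω' → E}
    (h : TendstoInDistribution H atTop H' μ μ') {ε : ℝ} (hε : 0 < ε) :
    ∃ K : ℝ, ∀ᶠ n in atTop, (μ n).real {ω | K ≤ ‖H n ω‖} < ε := by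
  have hm : ∀ k : ℕ, NullMeasurableSet (H' ⁻¹' {x | (k : ℝ) ≤ ‖x‖}) μ' := fun k =>
    h.aemeasurable_limit.nullMeasurable
      (isClosed_le continuous_const continuous_norm).measurableSet
  have ht := tendsto_measure_iInter_atTop (μ := μ')
    (s := fun k : ℕ => H' ⁻¹' {x | (k : ℝ) ≤ ‖x‖}) hm
    (fun i j hij x (hx : (j : ℝ) ≤ _) => (Nat.cast_le.2 hij).trans hx) ⟨0, measure_ne_top _ _⟩
  have he : ⋂ k : ℕ, H' ⁻¹' {x | (k : ℝ) ≤ ‖x‖} = ∅ := by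
    ext ω
    simp only [Set.mem_iInter, Set.mem_preimage, Set.mem_ofPred_eq, Set.mem_empty_iff_false,
      iff_false, not_forall, not_le]
    exact exists_nat_gt _
  rw [he, measure_empty] at ht
  obtain ⟨k, hk⟩ := (ht.eventually_lt_const (ENNReal.ofReal_pos.2 hε)).exists
  refine ⟨k, h.eventually_measureReal_lt (F := {x | (k : ℝ) ≤ ‖x‖})
    (isClosed_le continuous_const continuous_norm) ?_⟩
  rw [Function.comp_apply, ← ofReal_measureReal] at hk
  exact (ENNReal.ofReal_lt_ofReal_iff hε).1 hk

/-- Bounded convergence along a tight sequence, for integrands that become small uniformly on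
bounded sets. -/
lemma tendsto_integral_zero_of_tight [NormedAddCommGroup E] [BorelSpace E]
    {H : ∀ n, Ω n → E} {H' : Ω' → E} (h : TendstoInDistribution H atTop H' μ μ')
    {Φ : ∀ n, Ω n → ℂ} {M : ℝ} (hM : ∀ n, ∀ᵐ ω ∂μ n, ‖Φ n ω‖ ≤ M)
    (hΦ : ∀ K ε : ℝ, 0 < ε → ∀ᶠ n in atTop, ∀ᵐ ω ∂μ n, ‖H n ω‖ ≤ K → ‖Φ n ω‖ ≤ ε) :
    Tendsto (fun n => ∫ ω, Φ n ω ∂μ n) atTop (𝓝 0) := by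
  have hM' : ∀ n, ∀ᵐ ω ∂μ n, ‖Φ n ω‖ ≤ |M| := fun n =>
    (hM n).mono fun ω hω => hω.trans (le_abs_self M)
  rw [Metric.tendsto_nhds]
  intro ε hε
  -- The tail probability is chosen so that the tail contributes less than `ε / 2`; the `+ 1` covers
  -- `M = 0`.
  obtain ⟨K, hK⟩ := h.exists_eventually_measureReal_norm_lt (ε := ε / 2 / (|M| + 1)) (by positivity)
  filter_upwards [hK, hΦ K (ε / 2) (by positivity)] with n hn1 hn2
  have hs : NullMeasurableSet {ω | K ≤ ‖H n ω‖} (μ n) :=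
    (h.forall_aemeasurable n).nullMeasurable
      (isClosed_le continuous_const continuous_norm).measurableSet
  have hi : Integrable ({ω | K ≤ ‖H n ω‖}.indicator fun _ => |M|) (μ n) :=
    (integrable_const _).indicator₀ hs
  rw [dist_zero_right]
  calc ‖∫ ω, Φ n ω ∂μ n‖
      ≤ ∫ ω, (ε / 2 + {ω | K ≤ ‖H n ω‖}.indicator (fun _ => |M|) ω) ∂μ n := by
        refine norm_integral_le_of_norm_le ((integrable_const _).add hi) ?_
        filter_upwards [hM' n, hn2] with ω h1 h2
        by_cases hω : K ≤ ‖H n ω‖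
        · simp only [Set.indicator, Set.mem_ofPred_eq, hω, if_true]; linarith
        · simpa [Set.indicator, hω] using h2 (not_le.1 hω).le
    _ = ε / 2 + (μ n).real {ω | K ≤ ‖H n ω‖} * |M| := by
        rw [integral_add (integrable_const _) hi, integral_indicator₀ hs]
        simp
    _ ≤ ε / 2 + ε / 2 / (|M| + 1) * |M| := by gcongr
    _ < ε / 2 + ε / 2 / (|M| + 1) * (|M| + 1) := by gcongr; linarith
    _ = ε := by field_simp; ring

lemma tendstoInDistribution_of_tendsto_integral_exp {Y : ∀ n, Ω n → ℝ}
    (hY : ∀ n, AEMeasurable (Y n) (μ n)) {ν : Measure ℝ} [IsProbabilityMeasure ν]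
    (h : ∀ t : ℝ, Tendsto (fun n => ∫ ω, Complex.exp ((t * Y n ω : ℝ) * Complex.I) ∂μ n) atTop
      (𝓝 (charFun ν t))) :
    TendstoInDistribution Y atTop id μ ν where
  forall_aemeasurable := hY
  aemeasurable_limit := aemeasurable_id
  tendsto := by
    refine ProbabilityMeasure.tendsto_iff_tendsto_charFun.2 fun t => ?_
    simp only [ProbabilityMeasure.coe_mk, Measure.map_id]
    refine (h t).congr fun n => ?_
    rw [charFun_apply_real, integral_map (hY n) (by fun_prop)]
    simp

/-- Moves variables living on different spaces onto one product space without changing their laws,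
so that convergence in measure makes sense. -/
lemma _root_.MeasureTheory.TendstoInDistribution.comp_eval_infinitePi [TopologicalSpace E]
    [OpensMeasurableSpace E] {H : ∀ n, Ω n → E} {H' : Ω' → E}
    (h : TendstoInDistribution H atTop H' μ μ') :
    TendstoInDistribution (fun n (ω : ∀ n, Ω n) => H n (ω n)) atTop H'
      (fun _ => Measure.infinitePi μ) μ' where
  forall_aemeasurable n :=
    (h.forall_aemeasurable n).comp_quasiMeasurePreserving
      (measurePreserving_eval_infinitePi μ n).quasiMeasurePreserving
  aemeasurable_limit := h.aemeasurable_limit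
  tendsto := by
    refine h.tendsto.congr fun n => Subtype.ext ?_
    have he := measurePreserving_eval_infinitePi μ n
    have hH : AEMeasurable (H n) ((Measure.infinitePi μ).map (Function.eval n)) := by
      rw [he.map_eq]; exact h.forall_aemeasurable n
    have := AEMeasurable.map_map_of_aemeasurable hH he.measurable.aemeasurable
    rw [he.map_eq] at this
    exact this

lemma tendstoInMeasure_const_of_tendstoInDistribution {Y : ℕ → Ω' → ℝ} {c : ℝ}
    (h : TendstoInDistribution Y atTop id (fun _ => μ') (Measure.dirac c)) :
    TendstoInMeasure μ' Y atTop fun _ => c := by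
  rw [tendstoInMeasure_iff_measureReal_norm]
  intro ε hε
  rw [Metric.tendsto_nhds]
  intro δ hδ
  have hF : IsClosed {x : ℝ | ε ≤ ‖x - c‖} :=
    isClosed_le continuous_const (by fun_prop)
  filter_upwards [h.eventually_measureReal_lt hF (ε := δ) (by
    rw [Set.preimage_id, measureReal_def, Measure.dirac_apply' _ hF.measurableSet]
    simp [hε, hδ])] with n hn
  rw [dist_zero_right, Real.norm_eq_abs, abs_of_nonneg measureReal_nonneg]
  exact hn

end Distribution

/-! ### Taylor expansion of the characteristic function at scale `√(C/n)` -/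

section Expansion

variable {𝓧 : Type*} [MeasurableSpace 𝓧] {P : Measure 𝓧} {C : ℝ} {ρ g : 𝓧 → ℝ}

/-- The value is free of `ρ`: every valid ratio accepts with probability `1/C`, so the number of
acceptances is binomial whatever the estimator. -/
lemma stepCharFun_const (hρ : IsValidRatio P C ρ) (s : ℝ) :
    stepCharFun P C ρ (fun _ => s) = 1 + (C : ℂ)⁻¹ * (Complex.exp (s * Complex.I) - 1) := by
  rw [stepCharFun, integral_mul_const, integral_complex_ofReal, hρ.integral_eq_one,
    Complex.ofReal_one, one_mul]

variable [IsProbabilityMeasure P]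

lemma integrable_abs_pow_of_memLp_four (hg : MemLp g 4 P) {k : ℕ} (hk : k ≤ 4) :
    Integrable (fun x => |g x| ^ k) P :=
  (hg.mono_exponent (p := (k : ENNReal)) (by exact_mod_cast hk)).integrable_norm_pow'

lemma integrable_pow_of_memLp_four (hg : MemLp g 4 P) {k : ℕ} (hk : k ≤ 4) :
    Integrable (fun x => g x ^ k) P := by
  refine (integrable_abs_pow_of_memLp_four hg hk).mono (hg.aestronglyMeasurable.pow k)
    (ae_of_all _ fun x => ?_)
  simp

lemma norm_integral_exp_sub_taylor_le (hρ : IsValidRatio P C ρ) (hg : Measurable g)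
    (hg4 : MemLp g 4 P) (s : ℝ) :
    ‖∫ x, (ρ x : ℂ) * (Complex.exp ((s * g x : ℝ) * Complex.I) - 1) ∂P -
        (s * Complex.I * (∫ x, ρ x * g x ∂P : ℝ) - s ^ 2 / 2 * (∫ x, ρ x * g x ^ 2 ∂P : ℝ))‖ ≤
      C * (4 * |s| ^ 3 * ∫ x, |g x| ^ 3 ∂P) := by
  have h1 : Integrable (fun x => ρ x * g x) P := by
    simpa using hρ.integrable_mul (integrable_pow_of_memLp_four hg4 (k := 1) (by norm_num))
  have h2 : Integrable (fun x => ρ x * g x ^ 2) P :=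
    hρ.integrable_mul (integrable_pow_of_memLp_four hg4 (by norm_num))
  have h0 : Integrable
      (fun x => (ρ x : ℂ) * (Complex.exp ((s * g x : ℝ) * Complex.I) - 1)) P :=
    hρ.integrable_ofReal_mul (integrable_exp_sub_one (hg.const_mul s))
  have h1' : Integrable (fun x => s * Complex.I * ((ρ x * g x : ℝ) : ℂ)) P := h1.ofReal.const_mul _
  have h2' : Integrable (fun x => (s : ℂ) ^ 2 / 2 * ((ρ x * g x ^ 2 : ℝ) : ℂ)) P :=
    h2.ofReal.const_mul _
  have h12 : Integrable (fun x => s * Complex.I * ((ρ x * g x : ℝ) : ℂ) -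
      (s : ℂ) ^ 2 / 2 * ((ρ x * g x ^ 2 : ℝ) : ℂ)) P := h1'.sub h2'
  rw [← integral_complex_ofReal, ← integral_complex_ofReal, ← integral_const_mul,
    ← integral_const_mul, ← integral_sub h1' h2', ← integral_sub h0 h12,
    ← integral_const_mul, ← integral_const_mul]
  refine norm_integral_le_of_norm_le
    (((integrable_abs_pow_of_memLp_four hg4 (by norm_num)).const_mul _).const_mul _) ?_
  filter_upwards [hρ.bounds] with x hx
  have e : (ρ x : ℂ) * (Complex.exp ((s * g x : ℝ) * Complex.I) - 1) -
      (s * Complex.I * ((ρ x * g x : ℝ) : ℂ) - (s : ℂ) ^ 2 / 2 * ((ρ x * g x ^ 2 : ℝ) : ℂ)) =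
      (ρ x : ℂ) * (Complex.exp ((s * g x : ℝ) * Complex.I) - 1 - (s * g x : ℝ) * Complex.I +
        ((s * g x : ℝ) : ℂ) ^ 2 / 2) := by
    push_cast; ring
  rw [e, norm_mul, Complex.norm_real, Real.norm_eq_abs, abs_of_nonneg hx.1]
  have h3 := norm_exp_mul_I_taylor_two_le (s * g x)
  rw [abs_mul, mul_pow, ← mul_assoc] at h3
  exact mul_le_mul hx.2 h3 (norm_nonneg _) (hx.1.trans hx.2)

/-- The four errors come from the mean, the second moment, the Taylor remainder, and replacing `(1 +
b/n)^n` by `exp b`. The scale `s = t √(C/n)` is the one for which `n s² / C = t²` and `n s / C =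
(t/√C) √n`. -/
lemma norm_stepCharFun_pow_sub_exp_le (hρ : IsValidRatio P C ρ) (hg : Measurable g)
    (hg4 : MemLp g 4 P) (t y : ℝ) {σ2 : ℝ} (hσ : 0 ≤ σ2) {n : ℕ} (hn : 0 < n) {b : ℂ}
    (hb : b = (t / √C * y : ℝ) * Complex.I - (t ^ 2 / 2 * σ2 : ℝ)) (hbn : ‖b‖ ≤ n) :
    ‖stepCharFun P C ρ (fun x => t * √(C / n) * g x) ^ n - Complex.exp b‖ ≤
      |t| / √C * |√n * ∫ x, ρ x * g x ∂P - y| + t ^ 2 / 2 * |∫ x, ρ x * g x ^ 2 ∂P - σ2| +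
        4 * |t| ^ 3 * C * √(C / n) * ∫ x, |g x| ^ 3 ∂P + ‖b‖ ^ 2 / n := by
  have hC : 0 < C := by linarith [hρ.one_le]
  have hn' : (0 : ℝ) < n := by exact_mod_cast hn
  have hg' : Measurable fun x => t * √(C / n) * g x := hg.const_mul _
  set J := ∫ x, (ρ x : ℂ) * (Complex.exp ((t * √(C / n) * g x : ℝ) * Complex.I) - 1) ∂P with hJ
  have hR := norm_integral_exp_sub_taylor_le hρ hg hg4 (t * √(C / n))
  rw [← hJ] at hR
  set A := ∫ x, ρ x * g x ∂P
  set B := ∫ x, ρ x * g x ^ 2 ∂P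
  set M := ∫ x, |g x| ^ 3 ∂P
  have hre : b.re ≤ 0 := by
    rw [hb, Complex.sub_re, Complex.re_ofReal_mul, Complex.I_re, mul_zero, Complex.ofReal_re,
      zero_sub]
    exact neg_nonpos.2 (by positivity)
  have hz : stepCharFun P C ρ (fun x => t * √(C / n) * g x) = 1 + (n * (C : ℂ)⁻¹ * J) / n := by
    rw [stepCharFun, ← hJ, mul_assoc, mul_div_cancel_left₀ _ (by exact_mod_cast hn.ne')]
  have hmain := norm_pow_sub_exp_le hn hz (norm_stepCharFun_le_one hρ hg') hre hbn
  refine hmain.trans ?_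
  gcongr
  have hs2 : n * C⁻¹ * (t * √(C / n)) ^ 2 = t ^ 2 := by
    rw [mul_pow, Real.sq_sqrt (by positivity)]; field_simp
  have hs1 : n * C⁻¹ * (t * √(C / n)) = t / √C * √n := by
    rw [Real.sqrt_div hC.le]
    have h1 := Real.sq_sqrt hC.le
    have h2 := Real.sq_sqrt hn'.le
    have h3 : 0 < √C := Real.sqrt_pos.2 hC
    have h4 : 0 < √(n : ℝ) := Real.sqrt_pos.2 hn'
    field_simp
    rw [h1, h2]
    ring
  set s := t * √(C / n) with hs
  have e : n * (C : ℂ)⁻¹ * J - b =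
      (t / √C * (√n * A - y) : ℝ) * Complex.I - (t ^ 2 / 2 * (B - σ2) : ℝ) +
        n * (C : ℂ)⁻¹ * (J - (s * Complex.I * A - s ^ 2 / 2 * B)) := by
    have hs1' : (n : ℂ) * (C : ℂ)⁻¹ * s = (t / √C * √n : ℝ) := by
      rw [← hs1]; push_cast; ring
    have hs2' : (n : ℂ) * (C : ℂ)⁻¹ * s ^ 2 = (t ^ 2 : ℝ) := by
      rw [← hs2]; push_cast; ring
    have : n * (C : ℂ)⁻¹ * (J - (s * Complex.I * A - s ^ 2 / 2 * B)) =
        n * (C : ℂ)⁻¹ * J - (n * (C : ℂ)⁻¹ * s) * Complex.I * A +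
          (n * (C : ℂ)⁻¹ * s ^ 2) / 2 * B := by ring
    rw [this, hs1', hs2', hb]
    push_cast
    ring
  rw [e]
  calc _ ≤ ‖((t / √C * (√n * A - y) : ℝ) * Complex.I : ℂ)‖ + ‖((t ^ 2 / 2 * (B - σ2) : ℝ) : ℂ)‖ +
        ‖(n : ℂ) * (C : ℂ)⁻¹ * (J - (s * Complex.I * A - s ^ 2 / 2 * B))‖ :=
        (norm_add_le _ _).trans (add_le_add_left (norm_sub_le _ _) _)
    _ ≤ |t| / √C * |√n * A - y| + t ^ 2 / 2 * |B - σ2| + n * C⁻¹ * (C * (4 * |s| ^ 3 * M)) := by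
        gcongr ?_ + ?_ + ?_
        · rw [norm_mul, Complex.norm_I, mul_one, Complex.norm_real, Real.norm_eq_abs, abs_mul,
            abs_div, abs_of_nonneg (Real.sqrt_nonneg C)]
        · rw [Complex.norm_real, Real.norm_eq_abs, abs_mul, abs_of_nonneg (by positivity)]
        · rw [norm_mul, norm_mul, norm_inv, Complex.norm_natCast, Complex.norm_real,
            Real.norm_eq_abs, abs_of_pos hC]
          gcongr
    _ = _ := by
        have : n * C⁻¹ * (C * (4 * |s| ^ 3 * M)) =
            (n * C⁻¹ * s ^ 2) * (4 * C * |s| * M) := by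
          rw [← sq_abs s]; ring
        rw [this, hs2, hs, abs_mul, abs_of_nonneg (Real.sqrt_nonneg (C / n)), ← sq_abs t]
        ring

end Expansion

/-! ### Uniformity over parameters within `O(1/√n)` of `β₀` -/

section Uniformity

variable {𝓧 : Type*} [MeasurableSpace 𝓧] {P : Measure 𝓧} [IsProbabilityMeasure P] {C : ℝ}
  {E : Type*} [NormedAddCommGroup E] {r : 𝓧 → E → ℝ} {β₀ : E}

lemma eventually_forall_of_eventually_nhds [NormedSpace ℝ E] {p : E → Prop}
    (hp : ∀ᶠ β in 𝓝 β₀, p β) (K : ℝ) :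
    ∀ᶠ n : ℕ in atTop, ∀ β, ‖√(n : ℝ) • (β - β₀)‖ ≤ K → p β := by
  obtain ⟨δ, hδ, h⟩ := Metric.eventually_nhds_iff.1 hp
  have ht : Tendsto (fun n : ℕ => √(n : ℝ)) atTop atTop :=
    Real.tendsto_sqrt_atTop.comp tendsto_natCast_atTop_atTop
  filter_upwards [ht.eventually_gt_atTop (|K| / δ)] with n hn β hβ
  refine h ?_
  have hn0 : 0 < √(n : ℝ) := (by positivity : 0 ≤ |K| / δ).trans_lt hn
  rw [norm_smul, Real.norm_eq_abs, abs_of_pos hn0] at hβ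
  rw [dist_eq_norm]
  rw [div_lt_iff₀ hδ] at hn
  by_contra! hc
  have := mul_le_mul_of_nonneg_left hc hn0.le
  linarith [le_abs_self K]

/-- L² continuity against a square-integrable `k`, by Young's inequality `a c ≤ a²/(2q) + q c²/2`.
It is used with `k = g²`, which is where the fourth moment of `f` enters. -/
lemma eventually_abs_integral_mul_sub_le (hr₀ : IsValidRatio P C fun x => r x β₀)
    (hr_L2 : Tendsto (fun β => ∫⁻ x, ENNReal.ofReal (|r x β - r x β₀| ^ 2) ∂P) (𝓝 β₀) (𝓝 0))
    {k : 𝓧 → ℝ} (hk : Integrable k P) (hk2 : Integrable (fun x => k x ^ 2) P) {η : ℝ}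
    (hη : 0 < η) :
    ∀ᶠ β in 𝓝 β₀, IsValidRatio P C (fun x => r x β) →
      |∫ x, r x β * k x ∂P - ∫ x, r x β₀ * k x ∂P| ≤ η := by
  set M := ∫ x, k x ^ 2 ∂P with hM
  have hM0 : 0 ≤ M := integral_nonneg fun x => sq_nonneg _
  set q := η / (M + 1) with hq
  have hq0 : 0 < q := by positivity
  filter_upwards [hr_L2.eventually_lt_const (ENNReal.ofReal_pos.2 (mul_pos hq0 hη))] with β hβ hv
  have hΔm : AEStronglyMeasurable (fun x => (r x β - r x β₀) ^ 2) P :=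
    ((hv.measurable.sub hr₀.measurable).pow_const 2).aestronglyMeasurable
  have hΔ : ∫ x, (r x β - r x β₀) ^ 2 ∂P ≤ q * η := by
    rw [integral_eq_lintegral_of_nonneg_ae (ae_of_all _ fun x => sq_nonneg _) hΔm]
    simp_rw [sq_abs] at hβ
    exact ENNReal.toReal_le_of_le_ofReal (by positivity) hβ.le
  have hΔi : Integrable (fun x => (r x β - r x β₀) ^ 2) P := by
    refine Integrable.of_bound hΔm (C ^ 2) ?_
    filter_upwards [hv.bounds, hr₀.bounds] with x h1 h2
    rw [Real.norm_eq_abs, abs_of_nonneg (sq_nonneg _)]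
    exact sq_le_sq' (by linarith) (by linarith)
  rw [← integral_sub (hv.integrable_mul hk) (hr₀.integrable_mul hk), ← Real.norm_eq_abs]
  calc _ ≤ ∫ x, (1 / (2 * q) * (r x β - r x β₀) ^ 2 + q / 2 * k x ^ 2) ∂P := by
        refine norm_integral_le_of_norm_le ((hΔi.const_mul _).add (hk2.const_mul _))
          (ae_of_all _ fun x => ?_)
        rw [← sub_mul, Real.norm_eq_abs, abs_mul, ← sq_abs (r x β - r x β₀), ← sq_abs (k x)]
        set a := |r x β - r x β₀|
        set c := |k x|
        have : 1 / (2 * q) * a ^ 2 + q / 2 * c ^ 2 - a * c = 1 / (2 * q) * (a - q * c) ^ 2 := by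
          field_simp; ring
        have h0 : 0 ≤ 1 / (2 * q) * (a - q * c) ^ 2 := by positivity
        linarith
    _ = 1 / (2 * q) * ∫ x, (r x β - r x β₀) ^ 2 ∂P + q / 2 * M := by
        rw [integral_add (hΔi.const_mul _) (hk2.const_mul _), integral_const_mul,
          integral_const_mul]
    _ ≤ 1 / (2 * q) * (q * η) + q / 2 * (M + 1) := by gcongr; linarith
    _ = η := by rw [hq]; field_simp; ring

variable [InnerProductSpace ℝ E] [CompleteSpace E]

/-- As `r(·; β)` integrates to 1, the centring constant passes through the integral, leaving exactly
the increment of the differentiable map `β ↦ E_P [f r(·; β)]`. -/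
lemma eventually_abs_integral_mul_sub_inner_le
    {f : 𝓧 → ℝ} (hf : Integrable f P) {v : E}
    (hv : HasGradientAt (fun β => ∫ x, f x * r x β ∂P) v β₀) {η : ℝ} (hη : 0 < η) :
    ∀ᶠ β in 𝓝 β₀, IsValidRatio P C (fun x => r x β) →
      |∫ x, r x β * (f x - ∫ y, r y β₀ * f y ∂P) ∂P - inner ℝ v (β - β₀)| ≤ η * ‖β - β₀‖ := by
  filter_upwards [(hasGradientAt_iff_isLittleO.1 hv).def hη] with β hβ hval
  have e : ∫ x, r x β * (f x - ∫ y, r y β₀ * f y ∂P) ∂P =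
      ∫ x, f x * r x β ∂P - ∫ x, f x * r x β₀ ∂P := by
    simp_rw [mul_sub]
    rw [integral_sub (hval.integrable_mul hf) (hval.integrable.mul_const _), integral_mul_const,
      hval.integral_eq_one, one_mul]
    simp_rw [mul_comm]
  rw [e]
  exact hβ

/-- Asymptotics of the characteristic function of a normalized sum over the accepted points, uniform
over parameters at distance `O(1 / √n)` from `β₀`. -/
lemma eventually_norm_stepCharFun_pow_sub_exp_le (hr₀ : IsValidRatio P C fun x => r x β₀)
    (hr_L2 : Tendsto (fun β => ∫⁻ x, ENNReal.ofReal (|r x β - r x β₀| ^ 2) ∂P) (𝓝 β₀) (𝓝 0))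
    {f : 𝓧 → ℝ} (hfm : Measurable f) (hf4 : MemLp f 4 P) {v : E}
    (hv : HasGradientAt (fun β => ∫ x, f x * r x β ∂P) v β₀) {g : 𝓧 → ℝ}
    (hg : g = fun x => f x - ∫ y, r y β₀ * f y ∂P) {σ2 : ℝ}
    (hσ2 : σ2 = ∫ x, r x β₀ * g x ^ 2 ∂P) (t K : ℝ) {ε : ℝ} (hε : 0 < ε) :
    ∀ᶠ n : ℕ in atTop, ∀ β, IsValidRatio P C (fun x => r x β) → ‖√(n : ℝ) • (β - β₀)‖ ≤ K →
      ‖stepCharFun P C (fun x => r x β) (fun x => t * √(C / n) * g x) ^ n -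
        Complex.exp ((t / √C * inner ℝ v (√(n : ℝ) • (β - β₀)) : ℝ) * Complex.I -
          (t ^ 2 / 2 * σ2 : ℝ))‖ ≤ ε := by
  have hgm : Measurable g := by rw [hg]; exact hfm.sub_const _
  have hg4 : MemLp g 4 P := by rw [hg]; exact hf4.sub (memLp_const _)
  have hσ0 : 0 ≤ σ2 := by
    rw [hσ2]
    refine integral_nonneg_of_ae ?_
    filter_upwards [hr₀.bounds] with x hx using mul_nonneg hx.1 (sq_nonneg _)
  set M := ∫ x, |g x| ^ 3 ∂P
  set B := |t| / √C * (‖v‖ * |K|) + t ^ 2 / 2 * σ2 with hB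
  set D := |t| / √C * |K| + t ^ 2 / 2 with hD
  have hD0 : 0 ≤ D := by positivity
  -- The mean and second-moment errors total at most `η * D`, hence at most `ε / 2`.
  set η := ε / 2 / (D + 1) with hη
  have hη0 : 0 < η := by positivity
  have hA := eventually_forall_of_eventually_nhds
    (eventually_abs_integral_mul_sub_inner_le (C := C) (hf4.integrable (by norm_num)) hv hη0) K
  have hQ := eventually_forall_of_eventually_nhds
    (eventually_abs_integral_mul_sub_le hr₀ hr_L2
      (integrable_pow_of_memLp_four hg4 (k := 2) (by norm_num))
      (by simpa only [← pow_mul] using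
        integrable_pow_of_memLp_four hg4 (k := 2 * 2) (by norm_num)) hη0) K
  have hlim : Tendsto (fun n : ℕ => 4 * |t| ^ 3 * C * √(C / n) * M + B ^ 2 / n) atTop (𝓝 0) := by
    have h1 : Tendsto (fun n : ℕ => √(C / n)) atTop (𝓝 0) := by
      simpa using (tendsto_const_div_atTop_nhds_zero_nat C).sqrt
    simpa using ((h1.const_mul (4 * |t| ^ 3 * C)).mul_const M).add
      (tendsto_const_div_atTop_nhds_zero_nat (B ^ 2))
  filter_upwards [hA, hQ, hlim.eventually_lt_const (half_pos hε), eventually_gt_atTop 0,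
    (tendsto_natCast_atTop_atTop (R := ℝ)).eventually_ge_atTop B]
    with n hA hQ hn hn0 hnB β hβ hK
  have hA' := hA β hK hβ
  have hQ' := hQ β hK hβ
  rw [← hσ2] at hQ'
  have hA2 : |√n * ∫ x, r x β * g x ∂P - inner ℝ v (√(n : ℝ) • (β - β₀))| ≤ η * |K| := by
    rw [inner_smul_right, ← mul_sub, abs_mul, abs_of_nonneg (Real.sqrt_nonneg _)]
    rw [norm_smul, Real.norm_eq_abs, abs_of_nonneg (Real.sqrt_nonneg _)] at hK
    rw [hg]
    calc _ ≤ √n * (η * ‖β - β₀‖) := by gcongr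
      _ = η * (√n * ‖β - β₀‖) := by ring
      _ ≤ η * |K| := by gcongr; exact hK.trans (le_abs_self K)
  set y := inner ℝ v (√(n : ℝ) • (β - β₀)) with hy
  have hyK : |y| ≤ ‖v‖ * |K| :=
    (abs_real_inner_le_norm _ _).trans (by gcongr; exact hK.trans (le_abs_self K))
  set b : ℂ := (t / √C * y : ℝ) * Complex.I - (t ^ 2 / 2 * σ2 : ℝ) with hb
  have hbB : ‖b‖ ≤ B := by
    refine (norm_sub_le _ _).trans ?_
    rw [norm_mul, Complex.norm_I, mul_one, Complex.norm_real, Complex.norm_real, Real.norm_eq_abs,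
      Real.norm_eq_abs, abs_mul, abs_div, abs_of_nonneg (Real.sqrt_nonneg C),
      abs_of_nonneg (by positivity : 0 ≤ t ^ 2 / 2 * σ2)]
    rw [hB]
    gcongr
  refine (norm_stepCharFun_pow_sub_exp_le hβ hgm hg4 t y hσ0 hn0 hb (hbB.trans hnB)).trans ?_
  calc _ ≤ |t| / √C * (η * |K|) + t ^ 2 / 2 * η + 4 * |t| ^ 3 * C * √(C / n) * M + B ^ 2 / n := by
        gcongr
    _ = η * D + (4 * |t| ^ 3 * C * √(C / n) * M + B ^ 2 / n) := by rw [hD]; ring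
    _ ≤ η * (D + 1) + ε / 2 := by
        have : η * D ≤ η * (D + 1) := by gcongr; linarith
        linarith
    _ = ε := by rw [hη]; field_simp; ring

end Uniformity

/-! ### Limits of the acceptance rate and of the normalized sum -/

section Limit

lemma sum_accepted_const {𝓧 : Type*} {n : ℕ} {C : ℝ} (ρ : 𝓧 → ℝ) (x : Fin n → 𝓧)
    (u : Fin n → ℝ) (s : ℝ) :
    ∑ _i ∈ accepted ρ C x u, s = numAccepted ρ C x u * s := by
  rw [Finset.sum_const, nsmul_eq_mul, numAccepted]

variable {𝓧 : Type*} [MeasurableSpace 𝓧] {P : Measure 𝓧} {C : ℝ}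
  {Ω : ℕ → Type*} [∀ n, MeasurableSpace (Ω n)] {μ : ∀ n, Measure (Ω n)}
  {X : ∀ n, Ω n → Fin n → 𝓧} {U : ∀ n, Ω n → Fin n → ℝ}

section NumAccepted

variable {𝓩 : ℕ → Type*} [∀ n, MeasurableSpace (𝓩 n)] {ν : ∀ n, Measure (𝓩 n)}
  {Z : ∀ n, Ω n → 𝓩 n} {ρ : ∀ n, 𝓧 → 𝓩 n → ℝ}

lemma aemeasurable_sum_accepted
    (hlaw : ∀ n, HasLaw (fun ω => ((X n ω, U n ω), Z n ω))
      (((Measure.pi fun _ : Fin n => P).prod (Measure.pi fun _ : Fin n => unif01)).prod (ν n))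
      (μ n))
    (hρ : ∀ n, Measurable (Function.uncurry (ρ n))) {g : 𝓧 → ℝ} (hg : Measurable g) (n : ℕ) :
    AEMeasurable (fun ω => ∑ i ∈ accepted (fun x => ρ n x (Z n ω)) C (X n ω) (U n ω), g (X n ω i))
      (μ n) :=
  (measurable_sum_accepted (hρ n) hg C).comp_aemeasurable (hlaw n).aemeasurable

lemma aemeasurable_numAccepted
    (hlaw : ∀ n, HasLaw (fun ω => ((X n ω, U n ω), Z n ω))
      (((Measure.pi fun _ : Fin n => P).prod (Measure.pi fun _ : Fin n => unif01)).prod (ν n))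
      (μ n))
    (hρ : ∀ n, Measurable (Function.uncurry (ρ n))) (n : ℕ) :
    AEMeasurable (fun ω => (numAccepted (fun x => ρ n x (Z n ω)) C (X n ω) (U n ω) : ℝ)) (μ n) := by
  simpa only [sum_accepted_const, mul_one] using
    aemeasurable_sum_accepted (C := C) hlaw hρ (g := fun _ => (1 : ℝ)) measurable_const n

variable [IsProbabilityMeasure P] [∀ n, IsProbabilityMeasure (μ n)]
  [∀ n, IsProbabilityMeasure (ν n)]

/-- The acceptance rate converges in distribution to `1 / C`. -/
lemma tendstoInDistribution_numAccepted_div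
    (hlaw : ∀ n, HasLaw (fun ω => ((X n ω, U n ω), Z n ω))
      (((Measure.pi fun _ : Fin n => P).prod (Measure.pi fun _ : Fin n => unif01)).prod (ν n))
      (μ n))
    (hρ : ∀ n, Measurable (Function.uncurry (ρ n)))
    (hvalid : ∀ n, ∀ᵐ ω ∂μ n, IsValidRatio P C fun x => ρ n x (Z n ω)) :
    TendstoInDistribution
      (fun n ω => (numAccepted (fun x => ρ n x (Z n ω)) C (X n ω) (U n ω) : ℝ) / n) atTop id μ
      (Measure.dirac C⁻¹) := by
  refine tendstoInDistribution_of_tendsto_integral_exp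
    (fun n => (aemeasurable_numAccepted hlaw hρ n).div_const _) fun t => ?_
  have h1 : ∀ n : ℕ, ∫ ω, Complex.exp ((t *
      ((numAccepted (fun x => ρ n x (Z n ω)) C (X n ω) (U n ω) : ℝ) / n) : ℝ) * Complex.I) ∂μ n =
      (1 + (C : ℂ)⁻¹ * (Complex.exp ((t / n : ℝ) * Complex.I) - 1)) ^ n := by
    intro n
    have h2 := integral_exp_sum_accepted_eq (hlaw n) (hρ n) (hvalid n)
      (g := fun _ => t / n) measurable_const
    simp_rw [sum_accepted_const] at h2
    have h3 : ∀ᵐ ω ∂μ n, stepCharFun P C (fun x => ρ n x (Z n ω)) (fun _ => t / n) ^ n =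
        (1 + (C : ℂ)⁻¹ * (Complex.exp ((t / n : ℝ) * Complex.I) - 1)) ^ n := by
      filter_upwards [hvalid n] with ω hω
      rw [stepCharFun_const hω]
    rw [integral_congr_ae h3, integral_const, probReal_univ, one_smul] at h2
    rw [← h2]
    congr 1 with ω
    congr 3
    ring
  simp_rw [h1]
  have hlim : charFun (Measure.dirac C⁻¹) t = Complex.exp ((C : ℂ)⁻¹ * (t * Complex.I)) := by
    rw [charFun_dirac]
    congr 1
    simp
    ring
  rw [hlim]
  refine Complex.tendsto_one_add_pow_exp_of_tendsto ?_
  -- The slope of this function at 0 along `1/n` gives `n (exp (i t / n) - 1) → i t`.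
  have hd : HasDerivAt (fun s : ℂ => Complex.exp (s * (t * Complex.I))) (t * Complex.I) 0 := by
    simpa using ((hasDerivAt_id (0 : ℂ)).mul_const (t * Complex.I)).cexp
  have hs := hd.tendsto_slope_zero
  have hn : Tendsto (fun n : ℕ => (n : ℂ)⁻¹) atTop (𝓝[≠] 0) := by
    refine tendsto_nhdsWithin_iff.2 ⟨tendsto_inv_atTop_nhds_zero_nat, ?_⟩
    filter_upwards [eventually_gt_atTop 0] with n hn
    simpa using hn.ne'
  refine ((hs.comp hn).const_mul (C : ℂ)⁻¹).congr fun n => ?_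
  simp only [Function.comp_apply, zero_add, zero_mul, Complex.exp_zero, inv_inv, smul_eq_mul]
  push_cast
  rw [show (n : ℂ)⁻¹ * (t * Complex.I) = t / n * Complex.I by ring]
  ring

end NumAccepted

variable {𝓩 : ℕ → Type*} [∀ n, MeasurableSpace (𝓩 n)] {ν : ∀ n, Measure (𝓩 n)}
  {Z : ∀ n, Ω n → 𝓩 n}
  {d : ℕ} {r : 𝓧 → EuclideanSpace ℝ (Fin d) → ℝ} {β₀ v : EuclideanSpace ℝ (Fin d)}
  {βhat : ∀ n, 𝓩 n → EuclideanSpace ℝ (Fin d)} {S : Matrix (Fin d) (Fin d) ℝ} {f : 𝓧 → ℝ}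

/-- The limit law is that of an `N(0, σ2)` variable plus an independent `⟨v, W⟩ / √C` with `W ~ N(0,
S)`. -/
lemma charFun_gaussianReal_eq_mul (hC : 0 < C) (hS : S.PosSemidef) {σ2 : ℝ} (hσ : 0 ≤ σ2) (t : ℝ) :
    charFun (gaussianReal 0 (σ2 + dotProduct v.ofLp (S.mulVec v.ofLp) / C).toNNReal) t =
      Complex.exp (-(t ^ 2 / 2 * σ2 : ℝ)) *
        charFun (multivariateGaussian (0 : EuclideanSpace ℝ (Fin d)) S) ((t / √C) • v) := by
  have hv : 0 ≤ dotProduct v.ofLp (S.mulVec v.ofLp) := by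
    simpa using hS.dotProduct_mulVec_nonneg v.ofLp
  rw [charFun_gaussianReal, charFun_multivariateGaussian hS, ← Complex.exp_add,
    Real.coe_toNNReal _ (by positivity)]
  congr 1
  have h : (t / √C) ^ 2 = t ^ 2 / C := by rw [div_pow, Real.sq_sqrt hC.le]
  have h2 : dotProduct ((t / √C) • v).ofLp (S.mulVec ((t / √C) • v).ofLp) =
      t ^ 2 / C * dotProduct v.ofLp (S.mulVec v.ofLp) := by
    rw [← h, WithLp.ofLp_smul, Matrix.mulVec_smul, smul_dotProduct, dotProduct_smul, smul_eq_mul,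
      smul_eq_mul]
    ring
  rw [h2]
  simp
  ring

variable [IsProbabilityMeasure P] [∀ n, IsProbabilityMeasure (μ n)]
  [∀ n, IsProbabilityMeasure (ν n)]

/-- Asymptotic normality of the normalized sum over the accepted points. -/
lemma tendstoInDistribution_sum_accepted (hr : Measurable (Function.uncurry r))
    (hr₀ : IsValidRatio P C fun x => r x β₀)
    (hr_L2 : Tendsto (fun β => ∫⁻ x, ENNReal.ofReal (|r x β - r x β₀| ^ 2) ∂P) (𝓝 β₀) (𝓝 0))
    (hf : Measurable f) (hf4 : MemLp f 4 P)
    (hv : HasGradientAt (fun β => ∫ x, f x * r x β ∂P) v β₀)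
    (hlaw : ∀ n, HasLaw (fun ω => ((X n ω, U n ω), Z n ω))
      (((Measure.pi fun _ : Fin n => P).prod (Measure.pi fun _ : Fin n => unif01)).prod (ν n))
      (μ n))
    (hβ : ∀ n, Measurable (βhat n))
    (hvalid : ∀ n, ∀ᵐ ω ∂μ n, IsValidRatio P C fun x => r x (βhat n (Z n ω)))
    (hS : S.PosSemidef)
    (hAN : TendstoInDistribution (fun (n : ℕ) ω => √(n : ℝ) • (βhat n (Z n ω) - β₀)) atTop id μ
      (multivariateGaussian (0 : EuclideanSpace ℝ (Fin d)) S))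
    {g : 𝓧 → ℝ} (hg : g = fun x => f x - ∫ y, r y β₀ * f y ∂P) {σ2 : ℝ}
    (hσ2 : σ2 = ∫ x, r x β₀ * g x ^ 2 ∂P) :
    TendstoInDistribution
      (fun (n : ℕ) ω => √(C / n) *
        ∑ i ∈ accepted (fun x => r x (βhat n (Z n ω))) C (X n ω) (U n ω), g (X n ω i))
      atTop id μ
      (gaussianReal 0 (σ2 + dotProduct v.ofLp (S.mulVec v.ofLp) / C).toNNReal) := by
  have hC : 0 < C := by linarith [hr₀.one_le]
  have hgm : Measurable g := by rw [hg]; exact hf.sub_const _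
  have hσ0 : 0 ≤ σ2 := by
    rw [hσ2]
    refine integral_nonneg_of_ae ?_
    filter_upwards [hr₀.bounds] with x hx using mul_nonneg hx.1 (sq_nonneg _)
  have hρ : ∀ n, Measurable (Function.uncurry fun x z => r x (βhat n z)) := fun n =>
    hr.comp (f := fun p : 𝓧 × 𝓩 n => (p.1, βhat n p.2))
      (measurable_fst.prodMk ((hβ n).comp measurable_snd))
  have hZ : ∀ n, AEMeasurable (Z n) (μ n) := fun n =>
    measurable_snd.comp_aemeasurable (hlaw n).aemeasurable
  refine tendstoInDistribution_of_tendsto_integral_exp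
    (fun n => (aemeasurable_sum_accepted hlaw hρ hgm n).const_mul _) fun t => ?_
  have h1 : ∀ n : ℕ, ∫ ω, Complex.exp ((t * (√(C / n) *
      ∑ i ∈ accepted (fun x => r x (βhat n (Z n ω))) C (X n ω) (U n ω), g (X n ω i)) : ℝ) *
        Complex.I) ∂μ n =
      ∫ ω, stepCharFun P C (fun x => r x (βhat n (Z n ω))) (fun x => t * √(C / n) * g x) ^ n
        ∂μ n := by
    intro n
    rw [← integral_exp_sum_accepted_eq (hlaw n) (hρ n) (hvalid n) (hgm.const_mul (t * √(C / n)))]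
    simp_rw [← Finset.mul_sum, mul_assoc]
  simp_rw [h1]
  set H : ∀ n, Ω n → EuclideanSpace ℝ (Fin d) := fun n ω => √(n : ℝ) • (βhat n (Z n ω) - β₀)
    with hH
  set b : ∀ n, Ω n → ℂ := fun n ω =>
    (t / √C * inner ℝ v (H n ω) : ℝ) * Complex.I - (t ^ 2 / 2 * σ2 : ℝ) with hb
  have hexp : ∀ n ω, Complex.exp (b n ω) = Complex.exp (-(t ^ 2 / 2 * σ2 : ℝ)) *
      Complex.exp ((inner ℝ (H n ω) ((t / √C) • v) : ℝ) * Complex.I) := by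
    intro n ω
    rw [← Complex.exp_add, hb, inner_smul_right, real_inner_comm]
    congr 1
    ring
  have hbn : ∀ n ω, ‖Complex.exp (b n ω)‖ ≤ 1 := by
    intro n ω
    rw [hexp, norm_mul, Complex.norm_exp_ofReal_mul_I, mul_one, Complex.norm_exp,
      ← Complex.ofReal_neg, Complex.ofReal_re, Real.exp_le_one_iff]
    exact neg_nonpos.2 (by positivity)
  have hHm : ∀ n, AEMeasurable (H n) (μ n) := hAN.forall_aemeasurable
  have hbi : ∀ n, Integrable (fun ω => Complex.exp (b n ω)) (μ n) := fun n => by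
    refine Integrable.of_bound ?_ 1 (ae_of_all _ (hbn n))
    have := hHm n
    refine AEMeasurable.aestronglyMeasurable ?_
    simp only [hb]
    fun_prop
  have hψn : ∀ n, ∀ᵐ ω ∂μ n, ‖stepCharFun P C (fun x => r x (βhat n (Z n ω)))
      (fun x => t * √(C / n) * g x) ^ n‖ ≤ 1 := fun n => by
    filter_upwards [hvalid n] with ω hω
    rw [norm_pow]
    exact pow_le_one₀ (norm_nonneg _) (norm_stepCharFun_le_one hω (hgm.const_mul _))
  have hψi : ∀ n, Integrable (fun ω => stepCharFun P C (fun x => r x (βhat n (Z n ω)))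
      (fun x => t * √(C / n) * g x) ^ n) (μ n) := fun n =>
    Integrable.of_bound (((measurable_stepCharFun (hρ n) (hgm.const_mul _) C).pow_const
      n).comp_aemeasurable (hZ n)).aestronglyMeasurable 1 (hψn n)
  -- The conditional characteristic function may be replaced by `exp b`: the difference is bounded
  -- by 2 and is uniformly small where `√n (β̂ - β₀)` is bounded.
  have hdiff : Tendsto (fun n => ∫ ω, (stepCharFun P C (fun x => r x (βhat n (Z n ω)))
      (fun x => t * √(C / n) * g x) ^ n - Complex.exp (b n ω)) ∂μ n) atTop (𝓝 0) := by
    refine tendsto_integral_zero_of_tight hAN (M := 1 + 1) (fun n => ?_) fun K ε hε => ?_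
    · filter_upwards [hψn n] with ω hω
      exact (norm_sub_le _ _).trans (add_le_add hω (hbn n ω))
    · filter_upwards [eventually_norm_stepCharFun_pow_sub_exp_le hr₀ hr_L2 hf hf4 hv hg hσ2 t K hε]
        with n hn
      filter_upwards [hvalid n] with ω hω hK using hn _ hω hK
  have hlim : Tendsto (fun n => ∫ ω, Complex.exp (b n ω) ∂μ n) atTop
      (𝓝 (charFun (gaussianReal 0
        (σ2 + dotProduct v.ofLp (S.mulVec v.ofLp) / C).toNNReal) t)) := by
    rw [charFun_gaussianReal_eq_mul hC hS hσ0]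
    have hcf := (ProbabilityMeasure.tendsto_iff_tendsto_charFun.1 hAN.tendsto ((t / √C) • v))
    simp only [ProbabilityMeasure.coe_mk, Measure.map_id] at hcf
    refine (hcf.const_mul _).congr fun n => ?_
    simp_rw [hexp]
    rw [integral_const_mul, charFun_apply, integral_map (hHm n) (by fun_prop)]
  refine (hdiff.add hlim).congr (fun n => ?_) |>.trans (by rw [zero_add])
  rw [integral_sub (hψi n) (hbi n), sub_add_cancel]

end Limit

/-! ### Random normalization by the number of acceptances -/

section Statistic

variable {𝓧 : Type*} [MeasurableSpace 𝓧]

lemma centredMeanStat_acceptedSample {n : ℕ} (f : 𝓧 → ℝ) (Q : Measure 𝓧) (ρ : 𝓧 → ℝ) (C : ℝ)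
    (x : Fin n → 𝓧) (u : Fin n → ℝ) :
    centredMeanStat f Q (acceptedSample ρ C x u) = (√(numAccepted ρ C x u : ℝ))⁻¹ *
      ∑ i ∈ accepted ρ C x u, (f (x i) - ∫ y, f y ∂Q) := by
  rw [centredMeanStat]
  congr 1
  rw [← Finset.sum_coe_sort (accepted ρ C x u)]
  exact Equiv.sum_comp ((accepted ρ C x u).orderIsoOfFin rfl).toEquiv
    fun i : accepted ρ C x u => f (x i) - ∫ y, f y ∂Q

/-- Slutsky's theorem for a sum `s` normalized by the square root of a random count `k`,
where `k n / n` is close to `C⁻¹`. -/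
lemma tendstoInDistribution_inv_sqrt_mul {Ω : ℕ → Type*} [∀ n, MeasurableSpace (Ω n)]
    {μ : ∀ n, Measure (Ω n)} [∀ n, IsProbabilityMeasure (μ n)] {C : ℝ} (hC : 0 < C)
    {s k : ∀ n, Ω n → ℝ} {ν : Measure ℝ} [IsProbabilityMeasure ν]
    (hsm : ∀ n, AEMeasurable (s n) (μ n)) (hkm : ∀ n, AEMeasurable (k n) (μ n))
    (hs : TendstoInDistribution (fun (n : ℕ) ω => √(C / n) * s n ω) atTop id μ ν)
    (hk : TendstoInDistribution (fun n ω => k n ω / n) atTop id μ (Measure.dirac C⁻¹)) :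
    TendstoInDistribution (fun n ω => (√(k n ω))⁻¹ * s n ω) atTop id μ ν := by
  have hTm : ∀ n, AEMeasurable (fun ω => (√(k n ω))⁻¹ * s n ω) (μ n) := fun n =>
    (hkm n).sqrt.inv.mul (hsm n)
  set μ' := Measure.infinitePi μ
  have he := measurePreserving_eval_infinitePi μ
  have hmeas : ∀ {Y : ∀ n, Ω n → ℝ}, (∀ n, AEMeasurable (Y n) (μ n)) →
      ∀ n, AEMeasurable (fun ω : ∀ n, Ω n => Y n (ω n)) μ' := fun hY n =>
    (hY n).comp_quasiMeasurePreserving (he n).quasiMeasurePreserving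
  have hk' := tendstoInMeasure_const_of_tendstoInDistribution hk.comp_eval_infinitePi
  -- Truncating at `C⁻¹ / 2` keeps the denominator away from 0, so `φ` is continuous everywhere.
  -- Where `k / n ≥ C⁻¹ / 2` and `n > 0`, `φ (√(C/n) s, k/n)` is exactly `s / √k`.
  let φ : ℝ × ℝ → ℝ := fun p => p.1 / √(C * max p.2 (C⁻¹ / 2))
  have hpos : ∀ y : ℝ, 0 < C * max y (C⁻¹ / 2) := fun y =>
    mul_pos hC ((by positivity : 0 < C⁻¹ / 2).trans_le (le_max_right _ _))
  have hφ : Continuous φ := by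
    refine continuous_fst.div (by fun_prop) fun p => (Real.sqrt_pos.2 (hpos p.2)).ne'
  have hsl := hs.comp_eval_infinitePi.continuous_comp_prodMk_of_tendstoInMeasure_const hφ hk'
    (hmeas fun n => (hkm n).div_const _)
  have hφid : (fun x : ℝ => φ (id x, C⁻¹)) = id := by
    ext x
    have : max C⁻¹ (C⁻¹ / 2) = C⁻¹ := max_eq_left (half_le_self (by positivity))
    simp only [φ, this, mul_inv_cancel₀ hC.ne', Real.sqrt_one, div_one]
  rw [hφid] at hsl
  have hT := tendstoInDistribution_of_tendstoInMeasure_sub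
    (fun n (ω : ∀ n, Ω n) => (√(k n (ω n)))⁻¹ * s n (ω n)) id hsl ?_ (hmeas hTm)
  · refine ⟨hTm, aemeasurable_id, hT.tendsto.congr fun n => Subtype.ext ?_⟩
    have hH : AEMeasurable (fun ω => (√(k n ω))⁻¹ * s n ω) (μ'.map (Function.eval n)) := by
      rw [(he n).map_eq]; exact hTm n
    have := AEMeasurable.map_map_of_aemeasurable hH (he n).measurable.aemeasurable
    rw [(he n).map_eq] at this
    exact this.symm
  · rw [tendstoInMeasure_iff_measureReal_norm] at hk' ⊢
    intro ε hε
    -- The statistic and its truncated version can differ only when `k / n` is at least `C⁻¹ / 2`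
    -- away from `C⁻¹`, an event of vanishing probability that contains `k = 0`.
    refine squeeze_zero' (Eventually.of_forall fun n => measureReal_nonneg) ?_
      (hk' (C⁻¹ / 2) (by positivity))
    filter_upwards [eventually_gt_atTop 0] with n hn
    refine measureReal_mono fun ω hω => ?_
    by_contra hlt
    have hlt' : ‖k n (ω n) / n - C⁻¹‖ < C⁻¹ / 2 := not_le.1 hlt
    rw [Real.norm_eq_abs, abs_lt] at hlt'
    have hmax : max (k n (ω n) / n) (C⁻¹ / 2) = k n (ω n) / n := max_eq_left (by linarith)
    have hn' : (0 : ℝ) < n := by exact_mod_cast hn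
    have hk0 : 0 < k n (ω n) / n := by
      have : 0 < C⁻¹ / 2 := by positivity
      linarith
    have hkn : 0 < k n (ω n) := by
      have := mul_pos hk0 hn'
      rwa [div_mul_cancel₀ _ hn'.ne'] at this
    have hzero : (√(k n (ω n)))⁻¹ * s n (ω n) -
        φ (√(C / n) * s n (ω n), k n (ω n) / n) = 0 := by
      simp only [φ, hmax]
      rw [show C * (k n (ω n) / n) = C / n * k n (ω n) by ring,
        Real.sqrt_mul (by positivity : 0 ≤ C / n)]
      have h1 : 0 < √(C / n) := Real.sqrt_pos.2 (by positivity)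
      have h2 : 0 < √(k n (ω n)) := Real.sqrt_pos.2 hkn
      field_simp
      ring
    have hω' : ε ≤ ‖(√(k n (ω n)))⁻¹ * s n (ω n) -
        φ (√(C / n) * s n (ω n), k n (ω n) / n) - 0‖ := hω
    rw [hzero, sub_zero, norm_zero] at hω'
    linarith

end Statistic

end RejectionSampling

/-! ### The limit theorem for the accepted sample -/

theorem mainTheorem9
    {𝓧 : Type*} [MeasurableSpace 𝓧] (P Q : Measure 𝓧)
    [IsProbabilityMeasure P] [IsProbabilityMeasure Q]
    -- `Q` has a density with respect to `P` that is bounded by `C`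
    (C : ℝ) (hC : 0 < C) (hQP : Q ≪ P) (hQC : ∀ᵐ x ∂P, (Q.rnDeriv P x).toReal ≤ C)
    -- the parametric family `r(x; β)`, with `r(x; β₀) = dQ/dP`
    {d : ℕ} (r : 𝓧 → EuclideanSpace ℝ (Fin d) → ℝ) (hr : Measurable (Function.uncurry r))
    (β₀ : EuclideanSpace ℝ (Fin d)) (hr₀ : ∀ᵐ x ∂P, r x β₀ = (Q.rnDeriv P x).toReal)
    (hr_diff : ∀ᵐ x ∂P, DifferentiableAt ℝ (fun β => r x β) β₀)
    (hr_L2 : Tendsto (fun β => ∫⁻ x, ENNReal.ofReal (|r x β - r x β₀| ^ 2) ∂P) (𝓝 β₀) (𝓝 0))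
    -- the function `f`, and the gradient `v` at `β₀` of `β ↦ E_P [f(X) r(X; β)]`
    (f : 𝓧 → ℝ) (hf : Measurable f) (hf4 : Integrable (fun x => f x ^ 4) P)
    (v : EuclideanSpace ℝ (Fin d))
    (hv : HasGradientAt (fun β => ∫ x, f x * r x β ∂P) v β₀)
    -- for every `n`: the sample `X₁, …, Xₙ`, the uniform variables `U₁, …, Uₙ` and
    -- the separate sample `Z₁, …, Zₙ`, all independent
    {Ω : ℕ → Type*} [∀ n, MeasurableSpace (Ω n)] (μ : ∀ n, Measure (Ω n))
    [∀ n, IsProbabilityMeasure (μ n)]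
    (X : ∀ n, Ω n → Fin n → 𝓧) (U : ∀ n, Ω n → Fin n → ℝ) (Z : ∀ n, Ω n → Fin n → 𝓧)
    (hlaw : ∀ n, HasLaw (fun ω => ((X n ω, U n ω), Z n ω))
      (((Measure.pi fun _ : Fin n => P).prod
        (Measure.pi fun _ : Fin n => RejectionSampling.unif01)).prod
          (Measure.pi fun _ : Fin n => P)) (μ n))
    -- the estimator, a function of the separate sample, whose density ratio is almost surely valid
    (βhat : ∀ n, (Fin n → 𝓧) → EuclideanSpace ℝ (Fin d)) (hβ : ∀ n, Measurable (βhat n))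
    (hrhat : ∀ n, ∀ᵐ ω ∂μ n, ∫ x, r x (βhat n (Z n ω)) ∂P = 1 ∧
      ∀ᵐ x ∂P, 0 ≤ r x (βhat n (Z n ω)) ∧ r x (βhat n (Z n ω)) ≤ C)
    -- asymptotic normality of the estimator, with asymptotic covariance matrix `S`
    (S : Matrix (Fin d) (Fin d) ℝ) (hS : S.PosSemidef)
    (hAN : TendstoInDistribution (fun (n : ℕ) ω => Real.sqrt (n : ℝ) • (βhat n (Z n ω) - β₀)) atTop id μ
      (multivariateGaussian (0 : EuclideanSpace ℝ (Fin d)) S)) :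
    TendstoInDistribution
      (fun n ω => RejectionSampling.centredMeanStat f Q
        (RejectionSampling.acceptedSample (fun x => r x (βhat n (Z n ω))) C (X n ω) (U n ω)))
      atTop id μ
      (gaussianReal 0 (variance f Q + dotProduct v.ofLp (S.mulVec v.ofLp) / C).toNNReal) := by
  have hrm : ∀ β, Measurable fun x => r x β := fun β =>
    hr.comp (f := fun x => (x, β)) (by fun_prop)
  have hr₀v : RejectionSampling.IsValidRatio P C fun x => r x β₀ := by
    refine ⟨hrm β₀, ?_, ?_⟩
    · rw [integral_congr_ae hr₀, Measure.integral_toReal_rnDeriv hQP, probReal_univ]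
    · filter_upwards [hr₀, hQC] with x h1 h2
      rw [h1]
      exact ⟨ENNReal.toReal_nonneg, h2⟩
  have hvalid : ∀ n, ∀ᵐ ω ∂μ n,
      RejectionSampling.IsValidRatio P C fun x => r x (βhat n (Z n ω)) := fun n => by
    filter_upwards [hrhat n] with ω hω using ⟨hrm _, hω.1, hω.2⟩
  have hfL : MemLp f 4 P := by
    rw [← integrable_norm_rpow_iff hf.aestronglyMeasurable (by norm_num) (by norm_num)]
    refine hf4.congr (ae_of_all _ fun x => ?_)
    have : ((4 : ENNReal).toReal) = ((4 : ℕ) : ℝ) := by norm_num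
    simp only [this, Real.rpow_natCast, Real.norm_eq_abs]
    rw [Even.pow_abs (by decide)]
  -- Change of measure identifies the centring constant with `E_Q f` and the limiting second moment
  -- with `Var_Q f`.
  have hQint : ∀ k : 𝓧 → ℝ, ∫ x, r x β₀ * k x ∂P = ∫ x, k x ∂Q := fun k => by
    rw [← integral_rnDeriv_smul hQP]
    refine integral_congr_ae ?_
    filter_upwards [hr₀] with x hx
    rw [hx, smul_eq_mul]
  have hρ : ∀ n, Measurable (Function.uncurry fun x z => r x (βhat n z)) := fun n =>
    hr.comp (f := fun p : 𝓧 × (Fin n → 𝓧) => (p.1, βhat n p.2))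
      (measurable_fst.prodMk ((hβ n).comp measurable_snd))
  have hvar : variance f Q =
      ∫ x, r x β₀ * (fun x => f x - ∫ y, r y β₀ * f y ∂P) x ^ 2 ∂P := by
    rw [hQint, hQint, variance_eq_integral hf.aemeasurable]
  have hs := RejectionSampling.tendstoInDistribution_sum_accepted hr hr₀v hr_L2 hf hfL hv hlaw hβ
    hvalid hS hAN rfl hvar
  have hk := RejectionSampling.tendstoInDistribution_numAccepted_div hlaw hρ hvalid
  simp_rw [RejectionSampling.centredMeanStat_acceptedSample, ← hQint f]
  exact RejectionSampling.tendstoInDistribution_inv_sqrt_mul hC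
    (RejectionSampling.aemeasurable_sum_accepted (ρ := fun n x z => r x (βhat n z)) hlaw hρ
      (hf.sub_const _))
    (RejectionSampling.aemeasurable_numAccepted (ρ := fun n x z => r x (βhat n z)) hlaw hρ) hs hk
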